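/- Consider first-order temporal logic (without equality) over predicates $P$ of arity $\mathsf{ar}(P)\in\mathbb{N}$, constants and variables, with formulas \[ \varphi ::= P(\tau_1,\dots,\tau_{\mathsf{ar}(P)}) \mid \neg\varphi \mid (\varphi\wedge\varphi) \mid \exists x\,\varphi \mid (\varphi\,\mathcal{U}\,\varphi), \] where each term $\tau_i$ is a constant or a variable. A formula is \emph{monodic} if each of its subformulas of the form $\psi\,\mathcal{U}\,\chi$ has at most one free variable. The \emph{monadic monodic} fragment consists of the monodic formulas that contain no predicate of arity $\geq 2$; the \emph{two-variable monodic} fragment consists of the monodic formulas in which at most two variables occur. A \emph{finite trace} is given by a non-empty domain $\Delta$, a set of time points $[0,l]$ with $l\in\mathbb{N}$, an interpretation of each constant by an element of $\Delta$ (the same at all time points), and, for each $n\in[0,l]$ and each predicate $P$, a relation $P_n\subseteq\Delta^{\mathsf{ar}(P)}$. Satisfaction at a time point $n$ under an assignment of elements of $\Delta$ to the variables is as usual for atoms (evaluated in $P_n$), $\neg$, $\wedge$, $\exists$; and $\psi\,\mathcal{U}\,\chi$ holds at $n$ iff there is a time point $m\in[0,l]$ with $m>n$ such that $\chi$ holds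 at $m$ and $\psi$ holds at all $i$ with $n<i<m$. A formula is satisfied in a trace if it holds at time $0$ under some assignment. It is \emph{satisfiable on finite traces} if it is satisfied in some finite trace, and, for an integer $k>0$, \emph{satisfiable on $k$-bounded traces} if it is satisfied in some finite trace with at most $k$ time points. Let $|\varphi|$ be the number of occurrences of symbols (predicates, constants, variables, $\neg$, $\wedge$, $\exists$, $\mathcal{U}$; parentheses and commas not counted) in $\varphi$. \textbf{Theorem (bounded trace property).} Let $\varphi$ be a formula of the monadic monodic fragment or of the two-variable monodic fragment. If $\varphi$ is satisfiable on finite traces, then there is an integer $k$ with $0<k\leq 2^{2^{|\varphi|}}$ such that $\varphi$ is satisfiable on $k$-bounded traces. -/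

import Mathlib

universe u v w z

namespace FOTL

/-- Terms: individual names (constants) or variables. -/
inductive Term (Const : Type v) (Var : Type w) : Type (max v w)
  | const (c : Const)
  | var (x : Var)

namespace Term

variable {Const : Type v} {Var : Type w}

/-- The set of variables of a term (empty for a constant). -/
def vars : Term Const Var → Set Var
  | const _ => ∅
  | var x => {x}

end Term

/-- Formulas of first-order temporal logic (without equality) over the predicates `Pred` with
arities `ar`, the constants `Const` and the variables `Var`:
`P(τ₁, …, τₙ) | ¬ φ | (φ ∧ φ) | ∃ x φ | (φ U φ)`. -/
inductive Formula {Pred : Type u} (ar : Pred → ℕ) (Const : Type v) (Var : Type w) :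
    Type (max u v w)
  | atom (P : Pred) (τ : Fin (ar P) → Term Const Var)
  | neg (φ : Formula ar Const Var)
  | conj (φ ψ : Formula ar Const Var)
  | ex (x : Var) (φ : Formula ar Const Var)
  | untl (φ ψ : Formula ar Const Var)

namespace Formula

variable {Pred : Type u} {ar : Pred → ℕ} {Const : Type v} {Var : Type w}

/-- The set of free variables. -/
def freeVars : Formula ar Const Var → Set Var
  | atom _ τ => ⋃ i, (τ i).vars
  | neg φ => φ.freeVars
  | conj φ ψ => φ.freeVars ∪ ψ.freeVars
  | ex x φ => φ.freeVars \ {x}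
  | untl φ ψ => φ.freeVars ∪ ψ.freeVars

/-- The set of all variables that occur in a formula: free, bound, or next to a quantifier. -/
def vars : Formula ar Const Var → Set Var
  | atom _ τ => ⋃ i, (τ i).vars
  | neg φ => φ.vars
  | conj φ ψ => φ.vars ∪ ψ.vars
  | ex x φ => insert x φ.vars
  | untl φ ψ => φ.vars ∪ ψ.vars

/-- The set of subformulas, including the formula itself. -/
def sub : Formula ar Const Var → Set (Formula ar Const Var)
  | atom P τ => {atom P τ}
  | neg φ => insert (neg φ) φ.sub
  | conj φ ψ => insert (conj φ ψ) (φ.sub ∪ ψ.sub)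
  | ex x φ => insert (ex x φ) φ.sub
  | untl φ ψ => insert (untl φ ψ) (φ.sub ∪ ψ.sub)

/-- The size `|φ|`: the number of occurrences of symbols (predicates, constants, variables,
`¬`, `∧`, `∃`, `U`) in `φ`, where parentheses and commas are not counted. -/
def size : Formula ar Const Var → ℕ
  | atom P _ => 1 + ar P
  | neg φ => 1 + φ.size
  | conj φ ψ => 1 + φ.size + ψ.size
  | ex _ φ => 2 + φ.size
  | untl φ ψ => 1 + φ.size + ψ.size

/-- Monodic formulas: every subformula `ψ U χ` has at most one free variable. -/
def IsMonodic (φ : Formula ar Const Var) : Prop :=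
  ∀ ψ χ : Formula ar Const Var, untl ψ χ ∈ φ.sub → (untl ψ χ).freeVars.encard ≤ 1

/-- Monadic formulas: no predicate of arity at least two occurs. -/
def IsMonadic (φ : Formula ar Const Var) : Prop :=
  ∀ (P : Pred) (τ : Fin (ar P) → Term Const Var), atom P τ ∈ φ.sub → ar P ≤ 1

/-- The `p`-variable fragment: at most `p` variables occur. -/
def HasAtMostVars (p : ℕ) (φ : Formula ar Const Var) : Prop :=
  φ.vars.encard ≤ p

/-- The monadic monodic fragment. -/
def IsMonadicMonodic (φ : Formula ar Const Var) : Prop :=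
  φ.IsMonadic ∧ φ.IsMonodic

/-- The two-variable monodic fragment. -/
def IsTwoVariableMonodic (φ : Formula ar Const Var) : Prop :=
  φ.HasAtMostVars 2 ∧ φ.IsMonodic

end Formula

/-- A first-order temporal interpretation (trace) with a constant non-empty domain and rigid
constants. Its time points are the `n : ℕ` with `n ≤ last`, i.e. `[0, l]` if `last = l` and
`[0, ∞)` if `last = ⊤`. The value of `interp` at other `n` plays no role. -/
structure Trace {Pred : Type u} (ar : Pred → ℕ) (Const : Type v) : Type (max u v (z + 1)) where
  /-- the domain -/
  Dom : Type z
  nonempty_dom : Nonempty Dom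
  /-- the last time point, or `⊤` for an infinite trace -/
  last : ℕ∞
  /-- the extension of each predicate at each time point -/
  interp : ℕ → (P : Pred) → Set (Fin (ar P) → Dom)
  /-- the rigid interpretation of constants -/
  const : Const → Dom

namespace Trace

variable {Pred : Type u} {ar : Pred → ℕ} {Const : Type v} {Var : Type w}

/-- The set of time points. -/
def times (M : Trace.{u, v, z} ar Const) : Set ℕ := {n | (n : ℕ∞) ≤ M.last}

/-- Finite traces: the set of time points is `[0, l]` for some `l : ℕ`. -/
def IsFinite (M : Trace.{u, v, z} ar Const) : Prop := ∃ l : ℕ, M.last = l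

/-- Finite traces with at most `k` time points. -/
def IsBounded (k : ℕ) (M : Trace.{u, v, z} ar Const) : Prop :=
  M.IsFinite ∧ M.times.encard ≤ k

/-- The value of a term under an assignment. -/
def value (M : Trace.{u, v, z} ar Const) (a : Var → M.Dom) : Term Const Var → M.Dom
  | .const c => M.const c
  | .var x => a x

/-- Satisfaction of a formula in `M` at time point `n` under the assignment `a`. -/
def Sat (M : Trace.{u, v, z} ar Const) : ℕ → (Var → M.Dom) → Formula ar Const Var → Prop
  | n, a, .atom P τ => (fun i => M.value a (τ i)) ∈ M.interp n P
  | n, a, .neg φ => ¬ M.Sat n a φ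
  | n, a, .conj φ ψ => M.Sat n a φ ∧ M.Sat n a ψ
  | n, a, .ex x φ => ∃ a' : Var → M.Dom, (∀ y, y ≠ x → a' y = a y) ∧ M.Sat n a' φ
  | n, a, .untl φ ψ => ∃ m ∈ M.times, n < m ∧ M.Sat m a ψ ∧
      ∀ i, n < i → i < m → M.Sat i a φ

/-- `M` is a model of `φ`: `φ` holds at time `0` under some assignment. -/
def IsModel (M : Trace.{u, v, z} ar Const) (φ : Formula ar Const Var) : Prop :=
  ∃ a : Var → M.Dom, M.Sat 0 a φ

end Trace

/-- Satisfiability on finite traces (with domains in the universe `Type z`). -/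
def SatisfiableOnFinite {Pred : Type u} {ar : Pred → ℕ} {Const : Type v} {Var : Type w}
    (φ : Formula ar Const Var) : Prop :=
  ∃ M : Trace.{u, v, z} ar Const, M.IsFinite ∧ M.IsModel φ

/-- Satisfiability on `k`-bounded traces (with domains in the universe `Type z`). -/
def SatisfiableOnBounded {Pred : Type u} {ar : Pred → ℕ} {Const : Type v} {Var : Type w}
    (k : ℕ) (φ : Formula ar Const Var) : Prop :=
  ∃ M : Trace.{u, v, z} ar Const, M.IsBounded k ∧ M.IsModel φ

end FOTL

/-! Both fragments are monodic, and the argument works for every monodic formula. Give each domain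
element at time n its type, the set of until-subformulas true of it; the state at n records the
realized types and the types of the constants. If times n < m have the same state, the times n+1,
..., m can be cut out (`sat_splice`). Elements of the shortened trace are pairs (d, e) where d at n
and e at m have equal types; d supplies the past and e the future. Equal states make both
projections surjective, which preserves quantifiers as there is no equality. Monodicity makes each
until-formula at the seam a question about one pair. Hence the states in a shortest model are
pairwise distinct, and `card_states_le` bounds its length. -/

namespace FOTL

namespace Term

variable {Const : Type v} {Var : Type w}

/-- The set of constants of a term. -/
def consts : Term Const Var → Finset Const
  | const c => {c}
  | var _ => ∅

theorem card_consts_le (t : Term Const Var) : t.consts.card ≤ 1 := by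
  cases t <;> simp [consts]

end Term

/-! ### Counting until-subformulas and constants -/

namespace Formula

variable {Pred : Type u} {ar : Pred → ℕ} {Const : Type v} {Var : Type w}

open Classical in
/-- The set of constants that occur in a formula. -/
noncomputable def consts : Formula ar Const Var → Finset Const
  | atom _ τ => Finset.univ.biUnion fun i => (τ i).consts
  | neg φ => φ.consts
  | conj φ ψ => φ.consts ∪ ψ.consts
  | ex _ φ => φ.consts
  | untl φ ψ => φ.consts ∪ ψ.consts

open Classical in
/-- The set of subformulas of the form `ψ U χ`. -/
noncomputable def untils : Formula ar Const Var → Finset (Formula ar Const Var)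
  | atom _ _ => ∅
  | neg φ => φ.untils
  | conj φ ψ => φ.untils ∪ ψ.untils
  | ex _ φ => φ.untils
  | untl φ ψ => insert (untl φ ψ) (φ.untils ∪ ψ.untils)

/-- As U is binary, there are more predicate occurrences than occurrences of U; so each
until-subformula can be charged to two symbols, neither of them a constant. -/
theorem two_mul_card_untils_add_card_consts_lt_size (φ : Formula ar Const Var) :
    2 * φ.untils.card + φ.consts.card < φ.size := by
  classical
  induction φ with
  | atom P τ =>
    have h : (Finset.univ.biUnion fun i => (τ i).consts).card ≤ ar P :=
      Finset.card_biUnion_le.trans <|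
        (Finset.sum_le_sum fun i _ => (τ i).card_consts_le).trans (by simp)
    simp only [untils, consts, size, Finset.card_empty]
    convert (by omega : 2 * 0 + (Finset.univ.biUnion fun i => (τ i).consts).card < 1 + ar P)
  | neg φ ih => simp only [untils, consts, size]; omega
  | ex x φ ih => simp only [untils, consts, size]; omega
  | conj φ ψ ih₁ ih₂ =>
    have hu := Finset.card_union_le φ.untils ψ.untils
    have hc := Finset.card_union_le φ.consts ψ.consts
    simp only [untils, consts, size]; omega
  | untl φ ψ ih₁ ih₂ =>
    have hu := Finset.card_union_le φ.untils ψ.untils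
    have hi := Finset.card_insert_le (untl φ ψ) (φ.untils ∪ ψ.untils)
    have hc := Finset.card_union_le φ.consts ψ.consts
    simp only [untils, consts, size]; omega

theorem mem_sub_of_mem_untils {φ θ : Formula ar Const Var} (h : θ ∈ φ.untils) : θ ∈ φ.sub := by
  induction φ with
  | atom P τ => simp [untils] at h
  | neg φ ih => exact Or.inr (ih h)
  | ex x φ ih => exact Or.inr (ih h)
  | conj φ ψ ih₁ ih₂ =>
    simp only [untils, Finset.mem_union] at h
    exact Or.inr (h.imp ih₁ ih₂)
  | untl φ ψ ih₁ ih₂ =>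
    simp only [untils, Finset.mem_insert, Finset.mem_union] at h
    exact h.imp id (Or.imp ih₁ ih₂)

end Formula

/-! ### Until on a finite time line -/

/-- `A U B` at time `i` on the time points `[0, l]`, for truth values `A`, `B` over time. -/
def UntilOn (l : ℕ) (A B : ℕ → Prop) (i : ℕ) : Prop :=
  ∃ m, m ≤ l ∧ i < m ∧ B m ∧ ∀ k, i < k → k < m → A k

/-- Splits on whether the witness comes by time n. Beyond n, only the truth value of the until at n
itself matters, which localizes the effect of a cut to the seam. -/
theorem untilOn_iff_of_le {l n i : ℕ} {A B : ℕ → Prop} (hi : i ≤ n) (hn : n ≤ l) :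
    UntilOn l A B i ↔ UntilOn n A B i ∨ ((∀ k, i < k → k ≤ n → A k) ∧ UntilOn l A B n) := by
  constructor
  · rintro ⟨m, hm, him, hB, hA⟩
    rcases le_or_gt m n with h | h
    · exact .inl ⟨m, h, him, hB, hA⟩
    · exact .inr ⟨fun k h₁ h₂ => hA k h₁ (by omega), m, hm, h, hB,
        fun k h₁ h₂ => hA k (by omega) h₂⟩
  · rintro (⟨m, hm, him, hB, hA⟩ | ⟨h, m, hm, him, hB, hA⟩)
    · exact ⟨m, by omega, him, hB, hA⟩
    · exact ⟨m, hm, by omega, hB, fun k h₁ h₂ =>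
        if hk : k ≤ n then h k h₁ hk else hA k (by omega) h₂⟩

theorem untilOn_congr {l i : ℕ} {A B A' B' : ℕ → Prop}
    (hA : ∀ k, i < k → k ≤ l → (A k ↔ A' k)) (hB : ∀ k, i < k → k ≤ l → (B k ↔ B' k)) :
    UntilOn l A B i ↔ UntilOn l A' B' i := by
  constructor
  · rintro ⟨m, hm, him, h, h'⟩
    exact ⟨m, hm, him, (hB m him hm).1 h, fun k h₁ h₂ => (hA k h₁ (by omega)).1 (h' k h₁ h₂)⟩
  · rintro ⟨m, hm, him, h, h'⟩
    exact ⟨m, hm, him, (hB m him hm).2 h, fun k h₁ h₂ => (hA k h₁ (by omega)).2 (h' k h₁ h₂)⟩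

theorem untilOn_shift {l δ i : ℕ} (hδ : δ ≤ l) {A B : ℕ → Prop} :
    UntilOn (l - δ) (fun k => A (k + δ)) (fun k => B (k + δ)) i ↔ UntilOn l A B (i + δ) := by
  constructor
  · rintro ⟨m, hm, him, hB, hA⟩
    refine ⟨m + δ, by omega, by omega, hB, fun k h₁ h₂ => ?_⟩
    have := hA (k - δ) (by omega) (by omega)
    simpa only [Nat.sub_add_cancel (by omega : δ ≤ k)] using this
  · rintro ⟨m, hm, him, hB, hA⟩
    refine ⟨m - δ, by omega, by omega, ?_, fun k h₁ h₂ => hA _ (by omega) (by omega)⟩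
    simpa only [Nat.sub_add_cancel (by omega : δ ≤ m)] using hB

/-! ### Temporal types, states and the spliced trace -/

namespace Trace

variable {Pred : Type u} {ar : Pred → ℕ} {Const : Type v} {Var : Type w}

theorem sat_untl_iff (M : Trace.{u, v, z} ar Const) {l : ℕ} (hl : M.last = l) (n : ℕ)
    (a : Var → M.Dom) (ψ χ : Formula ar Const Var) :
    M.Sat n a (.untl ψ χ) ↔ UntilOn l (fun k => M.Sat k a ψ) (fun k => M.Sat k a χ) n := by
  simp [Sat, UntilOn, times, hl]

theorem sat_congr (M : Trace.{u, v, z} ar Const) {n : ℕ} {a b : Var → M.Dom}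
    {φ : Formula ar Const Var} (h : ∀ x ∈ φ.freeVars, a x = b x) :
    M.Sat n a φ ↔ M.Sat n b φ := by
  classical
  induction φ generalizing n a b with
  | atom P τ =>
    have : (fun i => M.value a (τ i)) = fun i => M.value b (τ i) := by
      funext i
      cases hτ : τ i with
      | const c => rfl
      | var x => exact h x (Set.mem_iUnion.2 ⟨i, by simp [hτ, Term.vars]⟩)
    simp only [Sat, this]
  | neg φ ih => exact not_congr (ih h)
  | conj φ ψ ih₁ ih₂ =>
    exact and_congr (ih₁ fun x hx => h x (.inl hx)) (ih₂ fun x hx => h x (.inr hx))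
  | ex x φ ih =>
    have key : ∀ a b : Var → M.Dom, (∀ y ∈ (Formula.ex x φ).freeVars, a y = b y) →
        M.Sat n a (.ex x φ) → M.Sat n b (.ex x φ) := by
      rintro a b h ⟨a', ha', hs⟩
      refine ⟨Function.update b x (a' x), fun y hy => Function.update_of_ne hy _ _,
        (ih fun y hy => ?_).1 hs⟩
      rcases eq_or_ne y x with rfl | hyx
      · simp
      · rw [Function.update_of_ne hyx, ha' y hyx, h y ⟨hy, hyx⟩]
    exact ⟨key a b h, key b a fun y hy => (h y hy).symm⟩
  | untl φ ψ ih₁ ih₂ =>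
    have h₁ : ∀ k, M.Sat k a φ ↔ M.Sat k b φ := fun k => ih₁ fun x hx => h x (.inl hx)
    have h₂ : ∀ k, M.Sat k a ψ ↔ M.Sat k b ψ := fun k => ih₂ fun x hx => h x (.inr hx)
    simp only [Sat, h₁, h₂]

/-- The temporal type of a domain element `d` at time `n`: the formulas from `U` that hold when
all variables take the value `d`. -/
def typeAt (M : Trace.{u, v, z} ar Const) (U : Finset (Formula ar Const Var)) (n : ℕ)
    (d : M.Dom) : Set U :=
  {θ | M.Sat n (fun _ => d) θ.1}

/-- The state at time `n`: the realized temporal types, and those of the constants in `C`. -/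
def stateAt (M : Trace.{u, v, z} ar Const) (U : Finset (Formula ar Const Var)) (C : Finset Const)
    (n : ℕ) : Set (Set U) × (C → Set U) :=
  (Set.range (M.typeAt U n), fun c => M.typeAt U n (M.const c))

theorem range_typeAt_eq {M : Trace.{u, v, z} ar Const} {U : Finset (Formula ar Const Var)}
    {C : Finset Const} {n m : ℕ} (h : M.stateAt U C n = M.stateAt U C m) :
    Set.range (M.typeAt U n) = Set.range (M.typeAt U m) :=
  congrArg Prod.fst h

open Classical in
/-- The trace obtained from `M` (with last time point `l`) by removing the times `n + 1, …, m`.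
Its elements are pairs of elements of `M` with equal temporal types at `n` and `m`; the first
component is used up to time `n` and the second one afterwards. -/
noncomputable def splice (M : Trace.{u, v, z} ar Const) (U : Finset (Formula ar Const Var))
    (l n m : ℕ) (hne : Nonempty {p : M.Dom × M.Dom // M.typeAt U n p.1 = M.typeAt U m p.2}) :
    Trace.{u, v, z} ar Const where
  Dom := {p : M.Dom × M.Dom // M.typeAt U n p.1 = M.typeAt U m p.2}
  nonempty_dom := hne
  last := ((l - (m - n) : ℕ) : ℕ∞)
  interp i P := if i ≤ n then {t | (fun j => (t j).1.1) ∈ M.interp i P}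
    else {t | (fun j => (t j).1.2) ∈ M.interp (i + (m - n)) P}
  -- Constants of the formula always fall in the first case when the states agree; `hne.some` is a
  -- dummy for the others.
  const c := if h : M.typeAt U n (M.const c) = M.typeAt U m (M.const c) then
    ⟨(M.const c, M.const c), h⟩ else hne.some

/-! ### Truth is preserved by splicing -/

section Splice

variable {M : Trace.{u, v, z} ar Const} {φ : Formula ar Const Var} {l n m : ℕ}
  {hne : Nonempty {p : M.Dom × M.Dom // M.typeAt φ.untils n p.1 = M.typeAt φ.untils m p.2}}

/-- The type of d at n is also realized at m, by a partner that completes the pair. -/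
theorem exists_fst_eq (h : M.stateAt φ.untils φ.consts n = M.stateAt φ.untils φ.consts m)
    (d : M.Dom) : ∃ p : (M.splice φ.untils l n m hne).Dom, p.1.1 = d := by
  have hd : M.typeAt φ.untils n d ∈ Set.range (M.typeAt φ.untils m) :=
    range_typeAt_eq h ▸ Set.mem_range_self d
  obtain ⟨e, he⟩ := hd
  exact ⟨⟨(d, e), he.symm⟩, rfl⟩

theorem exists_snd_eq (h : M.stateAt φ.untils φ.consts n = M.stateAt φ.untils φ.consts m)
    (d : M.Dom) : ∃ p : (M.splice φ.untils l n m hne).Dom, p.1.2 = d := by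
  have hd : M.typeAt φ.untils m d ∈ Set.range (M.typeAt φ.untils n) :=
    range_typeAt_eq h ▸ Set.mem_range_self d
  obtain ⟨e, he⟩ := hd
  exact ⟨⟨(e, d), he⟩, rfl⟩

theorem const_splice (h : M.stateAt φ.untils φ.consts n = M.stateAt φ.untils φ.consts m)
    {c : Const} (hc : c ∈ φ.consts) :
    ((M.splice φ.untils l n m hne).const c).1 = (M.const c, M.const c) := by
  have : M.typeAt φ.untils n (M.const c) = M.typeAt φ.untils m (M.const c) :=
    congrFun (congrArg Prod.snd h) ⟨c, hc⟩
  simp [splice, this]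

/-- A lifting argument for quantifiers: `f` is a surjection onto the domain of `M`. -/
theorem ex_congr_of_surjective {D E : Type z} {f : D → E} (hf : Function.Surjective f)
    {x : Var} {a : Var → D} {S : (Var → D) → Prop} {T : (Var → E) → Prop}
    (h : ∀ a, S a ↔ T (f ∘ a)) :
    (∃ a' : Var → D, (∀ y, y ≠ x → a' y = a y) ∧ S a') ↔
      ∃ b : Var → E, (∀ y, y ≠ x → b y = (f ∘ a) y) ∧ T b := by
  classical
  constructor
  · rintro ⟨a', h₁, h₂⟩
    exact ⟨f ∘ a', fun y hy => congrArg f (h₁ y hy), (h a').1 h₂⟩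
  · rintro ⟨b, h₁, h₂⟩
    obtain ⟨d, hd⟩ := hf (b x)
    have hb : f ∘ Function.update a x d = b := by
      funext y
      rcases eq_or_ne y x with rfl | hy
      · simp [hd]
      · simp [Function.update_of_ne hy, h₁ y hy]
    exact ⟨Function.update a x d, fun y hy => Function.update_of_ne hy _ _, (h _).2 (hb ▸ h₂)⟩

/-- Equal temporal types make monodic until-formulas equivalent. -/
theorem sat_iff_of_mem_untils (hφ : φ.IsMonodic) {ψ χ : Formula ar Const Var}
    (hmem : .untl ψ χ ∈ φ.untils) (a : Var → (M.splice φ.untils l n m hne).Dom) :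
    M.Sat n (fun x => (a x).1.1) (.untl ψ χ) ↔ M.Sat m (fun x => (a x).1.2) (.untl ψ χ) := by
  have hfree := Set.encard_le_one_iff_subsingleton.1
    (hφ ψ χ (Formula.mem_sub_of_mem_untils hmem))
  -- One pair represents the whole assignment: the value of the only free variable, or any pair for
  -- a sentence.
  obtain ⟨p, hp⟩ : ∃ p : (M.splice φ.untils l n m hne).Dom,
      ∀ x ∈ (Formula.untl ψ χ).freeVars, a x = p := by
    rcases hfree.eq_empty_or_singleton with h | ⟨x, h⟩
    · exact ⟨hne.some, by simp [h]⟩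
    · exact ⟨a x, by simp [h]⟩
  rw [M.sat_congr (b := fun _ => p.1.1) fun x hx => by rw [hp x hx],
    M.sat_congr (a := fun x => (a x).1.2) (b := fun _ => p.1.2) fun x hx => by rw [hp x hx]]
  exact Set.ext_iff.1 p.2 ⟨_, hmem⟩

/-- Induction on ψ, with past and future treated together, because an until before the seam may have
its witness after it. -/
theorem sat_splice (hφ : φ.IsMonodic) (hl : M.last = l) (hnm : n ≤ m) (hml : m ≤ l)
    (h : M.stateAt φ.untils φ.consts n = M.stateAt φ.untils φ.consts m)
    (ψ : Formula ar Const Var) (hU : ψ.untils ⊆ φ.untils) (hC : ψ.consts ⊆ φ.consts) :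
    (∀ i ≤ n, ∀ a, (M.splice φ.untils l n m hne).Sat i a ψ ↔
      M.Sat i (fun x => (a x).1.1) ψ) ∧
    (∀ i, n < i → ∀ a, (M.splice φ.untils l n m hne).Sat i a ψ ↔
      M.Sat (i + (m - n)) (fun x => (a x).1.2) ψ) := by
  classical
  induction ψ with
  | atom P τ =>
    have hc : ∀ j c, τ j = .const c → c ∈ φ.consts := fun j c hj =>
      hC (by simpa only [Formula.consts, Finset.mem_biUnion] using
        ⟨j, Finset.mem_univ j, by simp [hj, Term.consts]⟩)
    have h₁ : ∀ a j, ((M.splice φ.untils l n m hne).value a (τ j)).1.1 =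
        M.value (fun x => (a x).1.1) (τ j) := fun a j => by
      cases hτ : τ j with
      | const c => exact congrArg Prod.fst (const_splice h (hc j c hτ))
      | var x => rfl
    have h₂ : ∀ a j, ((M.splice φ.untils l n m hne).value a (τ j)).1.2 =
        M.value (fun x => (a x).1.2) (τ j) := fun a j => by
      cases hτ : τ j with
      | const c => exact congrArg Prod.snd (const_splice h (hc j c hτ))
      | var x => rfl
    constructor
    · intro i hi a
      have hP : (M.splice φ.untils l n m hne).interp i P =
          {t | (fun j => (t j).1.1) ∈ M.interp i P} := if_pos hi
      simp only [Sat, ← h₁, hP]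
      exact Iff.rfl
    · intro i hi a
      have hP : (M.splice φ.untils l n m hne).interp i P =
          {t | (fun j => (t j).1.2) ∈ M.interp (i + (m - n)) P} := if_neg hi.not_ge
      simp only [Sat, ← h₂, hP]
      exact Iff.rfl
  | neg ψ ih =>
    obtain ⟨ih₁, ih₂⟩ := ih hU hC
    exact ⟨fun i hi a => not_congr (ih₁ i hi a), fun i hi a => not_congr (ih₂ i hi a)⟩
  | conj ψ χ ihψ ihχ =>
    simp only [Formula.untils, Formula.consts, Finset.union_subset_iff] at hU hC
    obtain ⟨ih₁, ih₂⟩ := ihψ hU.1 hC.1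
    obtain ⟨ih₃, ih₄⟩ := ihχ hU.2 hC.2
    exact ⟨fun i hi a => and_congr (ih₁ i hi a) (ih₃ i hi a),
      fun i hi a => and_congr (ih₂ i hi a) (ih₄ i hi a)⟩
  | ex x ψ ih =>
    obtain ⟨ih₁, ih₂⟩ := ih hU hC
    exact ⟨fun i hi a => ex_congr_of_surjective (exists_fst_eq h) (ih₁ i hi),
      fun i hi a => ex_congr_of_surjective (exists_snd_eq h) (ih₂ i hi)⟩
  | untl ψ χ ihψ ihχ =>
    have hmem : .untl ψ χ ∈ φ.untils := hU (by simp [Formula.untils])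
    simp only [Formula.untils, Formula.consts, Finset.insert_subset_iff,
      Finset.union_subset_iff] at hU hC
    obtain ⟨ih₁, ih₂⟩ := ihψ hU.2.1 hC.1
    obtain ⟨ih₃, ih₄⟩ := ihχ hU.2.2 hC.2
    have hl' : (M.splice φ.untils l n m hne).last = ((l - (m - n) : ℕ) : ℕ∞) := rfl
    -- The case i = n is included: until is strict, so at n it sees only the future part, where
    -- second components are used. It thus agrees with time m of `M`.
    have late : ∀ i, n ≤ i → ∀ a, (M.splice φ.untils l n m hne).Sat i a (.untl ψ χ) ↔
        M.Sat (i + (m - n)) (fun x => (a x).1.2) (.untl ψ χ) := by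
      intro i hi a
      rw [sat_untl_iff _ hl', sat_untl_iff _ hl, ← untilOn_shift (by omega)]
      exact untilOn_congr (fun k hk _ => ih₂ k (by omega) a) fun k hk _ => ih₄ k (by omega) a
    refine ⟨fun i hi a => ?_, fun i hi => late i hi.le⟩
    -- Crossing the seam: equality of types trades the second component at m for the first component
    -- at n.
    have hn : (M.splice φ.untils l n m hne).Sat n a (.untl ψ χ) ↔
        M.Sat n (fun x => (a x).1.1) (.untl ψ χ) := by
      rw [late n le_rfl a, sat_iff_of_mem_untils hφ hmem, Nat.add_sub_cancel' hnm]
    rw [sat_untl_iff _ hl', sat_untl_iff _ hl] at hn ⊢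
    rw [untilOn_iff_of_le hi (by omega), untilOn_iff_of_le (l := l) hi (by omega), hn]
    refine or_congr (untilOn_congr (fun k _ hk => ih₁ k hk a) fun k _ hk => ih₃ k hk a)
      (and_congr_left' ?_)
    exact forall_congr' fun k => imp_congr_right fun _ => imp_congr_right fun hk => ih₁ k hk a

end Splice

/-! ### Shortening models and counting states -/

/-- A model with two time points in the same state can be shortened. -/
theorem exists_shorter_model {M : Trace.{u, v, z} ar Const} {φ : Formula ar Const Var}
    {l n m : ℕ} (hφ : φ.IsMonodic) (hl : M.last = l) (hnm : n < m) (hml : m ≤ l)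
    (h : M.stateAt φ.untils φ.consts n = M.stateAt φ.untils φ.consts m) (hM : M.IsModel φ) :
    ∃ l' < l, ∃ M' : Trace.{u, v, z} ar Const, M'.last = l' ∧ M'.IsModel φ := by
  obtain ⟨d⟩ := M.nonempty_dom
  have hd : M.typeAt φ.untils n d ∈ Set.range (M.typeAt φ.untils m) :=
    range_typeAt_eq h ▸ Set.mem_range_self d
  obtain ⟨e, he⟩ := hd
  have hne : Nonempty {p : M.Dom × M.Dom //
      M.typeAt φ.untils n p.1 = M.typeAt φ.untils m p.2} := ⟨⟨(d, e), he.symm⟩⟩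
  obtain ⟨a, ha⟩ := hM
  -- The assignment is lifted along the first projection, since time 0 lies in the past part.
  choose f hf using exists_fst_eq (l := l) (hne := hne) h
  refine ⟨l - (m - n), by omega, M.splice φ.untils l n m hne, rfl, fun x => f (a x), ?_⟩
  rw [(sat_splice hφ hl hnm.le hml h φ subset_rfl subset_rfl).1 0 (Nat.zero_le n)]
  simpa only [hf] using ha

/-- With s until-subformulas and c constants there are 2^(2^s) sets of types and 2^(sc) choices for
the constants. The exponent 2^s + sc is at most 2^(s+c+1), and s + c + 1 is at most the size. -/
theorem card_states_le (φ : Formula ar Const Var) :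
    Nat.card (Set (Set φ.untils) × (φ.consts → Set φ.untils)) ≤ 2 ^ 2 ^ φ.size := by
  classical
  have hcard : Nat.card (Set (Set φ.untils) × (φ.consts → Set φ.untils)) =
      2 ^ (2 ^ φ.untils.card + φ.untils.card * φ.consts.card) := by
    simp [Nat.card_eq_fintype_card, pow_add, pow_mul]
  rw [hcard]
  refine Nat.pow_le_pow_right two_pos ?_
  set s := φ.untils.card
  set c := φ.consts.card
  have h₁ : s * c ≤ 2 ^ s * 2 ^ c := Nat.mul_le_mul Nat.lt_two_pow_self.le Nat.lt_two_pow_self.le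
  have h₂ : 2 ^ s ≤ 2 ^ s * 2 ^ c := Nat.le_mul_of_pos_right _ (by positivity)
  calc 2 ^ s + s * c ≤ 2 ^ (s + c + 1) := by rw [pow_succ, pow_add]; omega
    _ ≤ 2 ^ φ.size := Nat.pow_le_pow_right two_pos (by
      have := φ.two_mul_card_untils_add_card_consts_lt_size
      omega)

end Trace

/-- The bounded trace property for monodic formulas. -/
theorem Formula.IsMonodic.exists_satisfiableOnBounded {Pred : Type u} {ar : Pred → ℕ}
    {Const : Type v} {Var : Type w} {φ : Formula ar Const Var} (hφ : φ.IsMonodic)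
    (hsat : SatisfiableOnFinite.{u, v, w, z} φ) :
    ∃ k : ℕ, 0 < k ∧ k ≤ 2 ^ 2 ^ φ.size ∧ SatisfiableOnBounded.{u, v, w, z} k φ := by
  classical
  have hex : ∃ l : ℕ, ∃ M : Trace.{u, v, z} ar Const, M.last = l ∧ M.IsModel φ := by
    obtain ⟨M, ⟨l, hl⟩, hM⟩ := hsat
    exact ⟨l, M, hl, hM⟩
  obtain ⟨M, hl, hM⟩ := Nat.find_spec hex
  -- The last time point l is chosen minimal among all finite models.
  have hmin := fun l' => Nat.find_min (m := l') hex
  generalize Nat.find hex = l at hl hmin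
  refine ⟨l + 1, l.succ_pos, ?_, M, ⟨⟨l, hl⟩, ?_⟩, hM⟩
  · refine le_trans ?_ (Trace.card_states_le φ)
    -- Pigeonhole: with more time points than states, two of them share a state, and the cut
    -- contradicts minimality.
    by_contra! hlt
    rw [Nat.card_eq_fintype_card] at hlt
    obtain ⟨i, j, hij, heq⟩ := Fintype.exists_ne_map_eq_of_card_lt
      (fun i : Fin (l + 1) => M.stateAt φ.untils φ.consts i) (by simpa using hlt)
    have step : ∀ i j : Fin (l + 1), i < j →
        M.stateAt φ.untils φ.consts i ≠ M.stateAt φ.untils φ.consts j := fun i j h heq => by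
      obtain ⟨l', hl', h'⟩ := Trace.exists_shorter_model hφ hl h (by omega) heq hM
      exact hmin l' hl' h'
    rcases lt_or_gt_of_ne hij with h | h
    · exact step i j h heq
    · exact step j i h heq.symm
  · have : M.times = Finset.range (l + 1) := by
      ext k
      simp [Trace.times, hl]
    rw [this, Set.encard_coe_eq_coe_finsetCard, Finset.card_range]

end FOTL

theorem mainTheorem8 {Pred : Type u} (ar : Pred → ℕ) (Const : Type v) (Var : Type w)
    (φ : FOTL.Formula ar Const Var)
    (hφ : φ.IsMonadicMonodic ∨ φ.IsTwoVariableMonodic)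
    (hsat : FOTL.SatisfiableOnFinite.{u, v, w, z} φ) :
    ∃ k : ℕ, 0 < k ∧ k ≤ 2 ^ 2 ^ φ.size ∧ FOTL.SatisfiableOnBounded.{u, v, w, z} k φ :=
  (hφ.elim (fun h => h.2) fun h => h.2).exists_satisfiableOnBounded hsat
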